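/- Let $1<p<\infty$. Let $L^p=L^p(\mathbb{T})$ for the unit circle $\mathbb{T}$, let $H^p\subset L^p$ be the Hardy space (the functions whose Fourier coefficients of negative index vanish), $K^p\subset L^p$ its standard complement (the functions whose Fourier coefficients of nonnegative index vanish), and $\mathbb{P}$ the Riesz projection of $L^p$ onto $H^p$ along $K^p$. Let $\mathrm{Rat}(\mathbb{T})$ be the set of rational functions all of whose poles in $\mathbb{C}$ lie on $\mathbb{T}$, and $\mathrm{Rat}_0(\mathbb{T})$ the set of strictly proper functions in $\mathrm{Rat}(\mathbb{T})$. For a rational function $\omega$ define the operator $T_\omega\,(H^p\to H^p)$ by $$\mathrm{Dom}(T_\omega)=\{g\in H^p : \omega g=f+\rho \text{ with } f\in L^p,\ \rho\in\mathrm{Rat}_0(\mathbb{T})\},\qquad T_\omega g=\mathbb{P}f .$$ Let $\mathcal{P}=\mathbb{C}[z]$ and $\mathcal{P}_n=\{r\in\mathcal{P}:\deg r\le n\}$, with $\mathcal{P}_{-1}=\{0\}$. Let $\omega\in\mathrm{Rat}(\mathbb{T})$ with $\omega\not\equiv 0$, say $\omega=s/q$ with $s,q\in\mathcal{P}$ coprime,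 and put $$\widetilde{\mathcal{P}}=\{r\in\mathcal{P} : rq=r_1s+r_2 \text{ for some } r_1,r_2\in\mathcal{P}_{\deg(q)-1}\}.$$ Then $T_\omega$ has closed range if and only if $s$ has no roots on $\mathbb{T}$, and $s$ has no roots on $\mathbb{T}$ if and only if $sH^p+\widetilde{\mathcal{P}}$ is closed in $H^p$. If $s$ has no roots on $\mathbb{T}$, then $$\mathrm{Dom}(T_\omega)=qH^p+\mathcal{P}_{\deg(q)-1}\quad\text{and}\quad \mathrm{Ran}(T_\omega)=sH^p+\widetilde{\mathcal{P}}.$$ -/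

import Mathlib

open MeasureTheory Polynomial
open scoped ENNReal

noncomputable section

namespace ToeplitzLike

/-- Normalised arc length on the unit circle `𝕋`, which is parametrised by
`t ↦ exp (2 π i t)`, `t ∈ ℝ / ℤ`. -/
abbrev circleMeasure : Measure UnitAddCircle := AddCircle.haarAddCircle

/-- The space `L^p = L^p(𝕋)`. -/
abbrev LpT (p : ℝ≥0∞) : Type := Lp ℂ p circleMeasure

/-- The point `z = exp (2 π i t)` of `𝕋 ⊂ ℂ` with parameter `t`. -/
def pt (t : UnitAddCircle) : ℂ := (AddCircle.toCircle t : ℂ)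

/-- The value of a rational function at a point (irrelevant at a pole; there are only
finitely many of these, so they form a null set of `𝕋`). -/
def ratEval (ψ : RatFunc ℂ) (z : ℂ) : ℂ := ψ.eval (RingHom.id ℂ) z

/-- `Rat(𝕋)`: the rational functions whose poles in `ℂ` all lie on `𝕋`. -/
def RatT : Set (RatFunc ℂ) := {ψ | ∀ z : ℂ, ψ.denom.IsRoot z → ‖z‖ = 1}

/-- `Rat₀(𝕋)`: the strictly proper rational functions in `Rat(𝕋)`. -/
def RatT0 : Set (RatFunc ℂ) := {ψ | ψ ∈ RatT ∧ ψ.num.degree < ψ.denom.degree}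

section Spaces

variable (p : ℝ≥0∞)

lemma fourierCoeff_smul (c : ℂ) (f : LpT p) (n : ℤ) :
    fourierCoeff (c • f : LpT p) n = c * fourierCoeff f n := by
  rw [fourierCoeff_congr_ae (Lp.coeFn_smul c f), fourierCoeff.const_smul]
  rfl

lemma fourierCoeff_zero (n : ℤ) : fourierCoeff (0 : LpT p) n = 0 := by
  simpa using fourierCoeff_smul p 0 0 n

variable [Fact (1 ≤ p)]

lemma integrable_LpT (f : LpT p) : Integrable f circleMeasure :=
  (Lp.memLp f).integrable Fact.out

lemma fourierCoeff_add (f g : LpT p) (n : ℤ) :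
    fourierCoeff (f + g : LpT p) n = fourierCoeff f n + fourierCoeff g n := by
  rw [fourierCoeff_congr_ae (Lp.coeFn_add f g),
    fourierCoeff.add (integrable_LpT p f) (integrable_LpT p g)]
  rfl

/-- The Hardy space `H^p`, as the subspace of `L^p(𝕋)` of the functions whose Fourier
coefficients of negative index vanish; it carries the norm of `L^p`. -/
def Hardy : Submodule ℂ (LpT p) where
  carrier := {f | ∀ n : ℤ, n < 0 → fourierCoeff f n = 0}
  add_mem' := fun {f g} hf hg n hn => by
    rw [fourierCoeff_add, hf n hn, hg n hn, add_zero]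
  zero_mem' := fun n _ => fourierCoeff_zero p n
  smul_mem' := fun c f hf n hn => by
    rw [fourierCoeff_smul, hf n hn, mul_zero]

/-- The standard complement `K^p` of `H^p` in `L^p`: the functions whose Fourier
coefficients of nonnegative index vanish. -/
def HardyCompl : Submodule ℂ (LpT p) where
  carrier := {f | ∀ n : ℤ, 0 ≤ n → fourierCoeff f n = 0}
  add_mem' := fun {f g} hf hg n hn => by
    rw [fourierCoeff_add, hf n hn, hg n hn, add_zero]
  zero_mem' := fun n _ => fourierCoeff_zero p n
  smul_mem' := fun c f hf n hn => by
    rw [fourierCoeff_smul, hf n hn, mul_zero]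

open Classical in
/-- The Riesz projection `ℙ` of `L^p` onto `H^p` along `K^p`: `ℙ f` is the element `h` of
`H^p` with `f - h ∈ K^p`. It exists for every `f ∈ L^p` when `1 < p < ∞` (M. Riesz);
the value `0` is used where there is none. -/
def rieszProj (f : LpT p) : Hardy p :=
  if h : ∃ h : Hardy p, f - (h : LpT p) ∈ HardyCompl p then h.choose else 0

/-- `ω g = f + ρ` as functions on `𝕋`. -/
def IsSplitting (ω : RatFunc ℂ) (g f : LpT p) (ρ : RatFunc ℂ) : Prop :=
  ∀ᵐ t ∂circleMeasure, ratEval ω (pt t) * g t = f t + ratEval ρ (pt t)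

/-- The Toeplitz-like operator `T_ω (H^p → H^p)`, a partially defined map: its domain consists
of the `g ∈ H^p` with `ω g = f + ρ` for some `f ∈ L^p` and `ρ ∈ Rat₀(𝕋)`, and
`T_ω g = ℙ f` (`f` is unique, see `toeplitz_eq`). -/
def toeplitz (ω : RatFunc ℂ) : Hardy p →. Hardy p := fun g =>
  ⟨∃ f : LpT p, ∃ ρ ∈ RatT0, IsSplitting p ω g f ρ, fun h => rieszProj p h.choose⟩

/-- For a polynomial `a` and a set `R` of polynomials, the subset `a H^p + R` of `H^p`. -/
def mulAdd (a : ℂ[X]) (R : Set ℂ[X]) : Set (Hardy p) :=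
  {F | ∃ h : Hardy p, ∃ r ∈ R,
    ∀ᵐ t ∂circleMeasure, (F : LpT p) t = a.eval (pt t) * (h : LpT p) t + r.eval (pt t)}

end Spaces

/-- `𝒫_{n-1}`: the polynomials of degree less than `n` (only `0` if `n = 0`). -/
def polyLT (n : ℕ) : Set ℂ[X] := {r | r.degree < n}

/-- `𝒫̃ = {r ∈ 𝒫 : r q = r₁ s + r₂ for some r₁, r₂ ∈ 𝒫_{deg q - 1}}`. -/
def tildeP (s q : ℂ[X]) : Set ℂ[X] :=
  {r | ∃ r₁ ∈ polyLT q.natDegree, ∃ r₂ ∈ polyLT q.natDegree, r * q = r₁ * s + r₂}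

/-! ### The operator is well defined -/

section WellDefined

lemma volume_eq_circleMeasure : (volume : Measure UnitAddCircle) = circleMeasure := by
  have := AddCircle.volume_eq_smul_haarAddCircle (T := (1 : ℝ))
  simpa using this

lemma pt_coe (x : ℝ) : pt (x : UnitAddCircle) = Complex.exp (2 * Real.pi * Complex.I * x) := by
  have h := fourier_coe_apply (T := (1 : ℝ)) (n := 1) (x := x)
  rw [fourier_one] at h
  simpa [pt] using h

/-- A strictly proper rational function with poles only on `𝕋` that is integrable over `𝕋`
is zero. -/
lemma eq_zero_of_integrable {ψ : RatFunc ℂ} (h0 : ψ ∈ RatT0)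
    (hi : Integrable (fun t => ratEval ψ (pt t)) circleMeasure) : ψ = 0 := by
  by_cases hdeg : ψ.denom.degree = 0
  · have h1 := h0.2
    rw [hdeg] at h1
    have h2 : ψ.num = 0 := by
      by_contra h
      exact absurd (zero_le_degree_iff.2 h) (not_le.2 h1)
    exact RatFunc.num_eq_zero_iff.1 h2
  exfalso
  obtain ⟨α, hα⟩ := IsAlgClosed.exists_root ψ.denom hdeg
  have hα1 : ‖α‖ = 1 := h0.1 α hα
  have hnum : ψ.num.eval α ≠ 0 := by
    intro h
    obtain ⟨a, b, hab⟩ := RatFunc.isCoprime_num_denom ψ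
    have := congrArg (Polynomial.eval α) hab
    rw [Polynomial.eval_add, Polynomial.eval_mul, Polynomial.eval_mul, h, hα.eq_zero] at this
    simp at this
  set e : ℝ → ℂ := fun x => Complex.exp (2 * Real.pi * Complex.I * x) with he
  obtain ⟨c, hc⟩ : ∃ c : ℝ, e c = α := by
    refine ⟨Complex.arg α / (2 * Real.pi), ?_⟩
    have h1 := Complex.norm_mul_exp_arg_mul_I α
    rw [hα1, Complex.ofReal_one, one_mul] at h1
    have h2 : (Real.pi : ℂ) ≠ 0 := by exact_mod_cast Real.pi_ne_zero
    have h3 : 2 * (Real.pi : ℂ) * Complex.I * ((α.arg / (2 * Real.pi) : ℝ) : ℂ)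
        = α.arg * Complex.I := by
      push_cast
      field_simp
    simp only [he]
    rw [h3, h1]
  have hde : ∀ x, HasDerivAt e (e x * (2 * Real.pi * Complex.I)) x := by
    intro x
    have h1 : HasDerivAt (fun y : ℝ => 2 * Real.pi * Complex.I * (y : ℂ))
        (2 * Real.pi * Complex.I) x := by
      simpa using (Complex.ofRealCLM.hasDerivAt (x := x)).const_mul (2 * Real.pi * Complex.I)
    exact h1.cexp
  -- the integrand on the line is not integrable near `c`
  have hO : (fun x : ℝ => (x - c)⁻¹) =O[nhdsWithin c {c}ᶜ] (fun x => ratEval ψ (e x)) := by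
    have hD : HasDerivAt (fun x => ψ.denom.eval (e x))
        (ψ.denom.derivative.eval (e c) * (e c * (2 * Real.pi * Complex.I))) c :=
      (ψ.denom.hasDerivAt (e c)).comp c (hde c)
    have hD1 : (fun x => ψ.denom.eval (e x)) =O[nhds c] (fun x : ℝ => x - c) := by
      have := hD.isBigO_sub
      simpa [hc, hα.eq_zero] using this
    have hN : (fun _ : ℝ => (1 : ℝ)) =O[nhds c] (fun x => ψ.num.eval (e x)) := by
      have hcont : ContinuousAt (fun x => ψ.num.eval (e x)) c :=
        (ψ.num.continuous.continuousAt).comp (hde c).continuousAt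
      refine (Asymptotics.isBigO_const_left_iff_pos_le_norm one_ne_zero).2
        ⟨‖ψ.num.eval α‖ / 2, half_pos (norm_pos_iff.2 hnum), ?_⟩
      have h2 := hcont.norm.tendsto
      rw [hc] at h2
      filter_upwards [h2.eventually (lt_mem_nhds (half_lt_self (norm_pos_iff.2 hnum)))]
        with x hx using hx.le
    have hnz : ∀ᶠ x in nhdsWithin c {c}ᶜ, ψ.denom.eval (e x) ≠ 0 := by
      have h1 : ∀ᶠ z in nhdsWithin α {α}ᶜ, ψ.denom.eval z ≠ 0 := by
        have hf : {z | z ∈ ψ.denom.roots.toFinset ∧ z ≠ α}.Finite :=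
          (ψ.denom.roots.toFinset.finite_toSet).subset (fun z hz => hz.1)
        have h3 : {z | z ∈ ψ.denom.roots.toFinset ∧ z ≠ α}ᶜ ∈ nhds α :=
          hf.isClosed.isOpen_compl.mem_nhds (by simp)
        filter_upwards [mem_nhdsWithin_of_mem_nhds h3, self_mem_nhdsWithin] with z hz hz' h
        exact hz ⟨by simpa [ψ.denom_ne_zero] using h, hz'⟩
      have hα0 : α ≠ 0 := by
        rintro rfl
        simp at hα1
      have h2 := (hde c).tendsto_nhdsNE (by rw [hc]; simp [hα0, Real.pi_ne_zero])
      rw [hc] at h2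
      exact h2.eventually h1
    have hinv : (fun x : ℝ => (x - c)⁻¹) =O[nhdsWithin c {c}ᶜ]
        (fun x => (ψ.denom.eval (e x))⁻¹) :=
      (hD1.mono nhdsWithin_le_nhds).inv_rev (hnz.mono fun x hx h => absurd h hx)
    have := (hN.mono nhdsWithin_le_nhds).mul hinv
    simpa [ratEval, RatFunc.eval, div_eq_mul_inv, Polynomial.eval₂_id] using this
  refine not_intervalIntegrable_of_sub_inv_isBigO_punctured hO (a := c) (b := c + 1)
    (by simp) (by simp) ?_
  rw [intervalIntegrable_iff_integrableOn_Ioc_of_le (by simp)]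
  rw [← volume_eq_circleMeasure] at hi
  have := (UnitAddCircle.measurePreserving_mk c).integrable_comp_of_integrable hi
  refine this.congr (Filter.Eventually.of_forall fun x => ?_)
  simp [pt_coe, he]

lemma RatT0_sub {ψ χ : RatFunc ℂ} (hψ : ψ ∈ RatT0) (hχ : χ ∈ RatT0) : ψ - χ ∈ RatT0 := by
  have hd : ψ.denom * χ.denom ≠ 0 := mul_ne_zero ψ.denom_ne_zero χ.denom_ne_zero
  set n : ℂ[X] := ψ.num * χ.denom - χ.num * ψ.denom with hn
  have hψχ : ψ - χ = algebraMap ℂ[X] (RatFunc ℂ) n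
      / algebraMap ℂ[X] (RatFunc ℂ) (ψ.denom * χ.denom) := by
    have h1 : algebraMap ℂ[X] (RatFunc ℂ) ψ.denom ≠ 0 :=
      RatFunc.algebraMap_ne_zero ψ.denom_ne_zero
    have h2 : algebraMap ℂ[X] (RatFunc ℂ) χ.denom ≠ 0 :=
      RatFunc.algebraMap_ne_zero χ.denom_ne_zero
    conv_lhs => rw [← RatFunc.num_div_denom ψ, ← RatFunc.num_div_denom χ]
    rw [hn, map_sub, map_mul, map_mul, map_mul]
    field_simp
  have hdvd : (ψ - χ).denom ∣ ψ.denom * χ.denom := by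
    rw [RatFunc.denom_dvd hd]
    exact ⟨n, hψχ⟩
  refine ⟨fun z hz => ?_, ?_⟩
  · have h1 := hz.dvd hdvd
    rw [Polynomial.IsRoot.def, Polynomial.eval_mul, mul_eq_zero] at h1
    exact h1.elim (hψ.1 z) (hχ.1 z)
  · have hlt : n.degree < (ψ.denom * χ.denom).degree := by
      rw [hn]
      refine lt_of_le_of_lt (Polynomial.degree_sub_le _ _) (max_lt ?_ ?_)
      · rw [degree_mul, degree_mul]
        exact WithBot.add_lt_add_right (degree_ne_bot.2 χ.denom_ne_zero) hψ.2
      · rw [degree_mul, degree_mul, add_comm]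
        exact WithBot.add_lt_add_left (degree_ne_bot.2 ψ.denom_ne_zero) hχ.2
    have hcross : (ψ - χ).num * (ψ.denom * χ.denom) = n * (ψ - χ).denom :=
      (RatFunc.num_mul_eq_mul_denom_iff hd).2 hψχ
    by_contra hcon
    have h1 : (n * (ψ - χ).denom).degree < (ψ.denom * χ.denom).degree + (ψ - χ).denom.degree := by
      rw [degree_mul]
      exact WithBot.add_lt_add_right (degree_ne_bot.2 (ψ - χ).denom_ne_zero) hlt
    rw [← hcross, degree_mul, add_comm] at h1
    exact absurd h1 (not_lt.2 (add_le_add_right (not_lt.1 hcon) _))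

lemma pt_ne_ae (S : Set ℂ) (hS : S.Finite) : ∀ᵐ t ∂circleMeasure, pt t ∉ S := by
  have hinj : Function.Injective pt := fun a b h =>
    AddCircle.injective_toCircle one_ne_zero (Circle.ext h)
  have hfin : (pt ⁻¹' S).Finite := hS.preimage hinj.injOn
  have : Nontrivial UnitAddCircle := by
    refine ⟨((1 / 2 : ℝ) : UnitAddCircle), ((0 : ℝ) : UnitAddCircle), fun h => ?_⟩
    have h1 := congrArg pt h
    rw [pt_coe, pt_coe] at h1
    have h2 : 2 * (Real.pi : ℂ) * Complex.I * ((1 / 2 : ℝ) : ℂ) = Real.pi * Complex.I := by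
      push_cast
      ring
    rw [h2, Complex.exp_pi_mul_I] at h1
    norm_num at h1
  exact hfin.countable.ae_notMem circleMeasure

/-- In the definition of `T_ω`, the function `f` (and `ρ`) is determined by `g`. -/
lemma splitting_unique {p : ℝ≥0∞} [Fact (1 ≤ p)] {ω : RatFunc ℂ} {g f₁ f₂ : LpT p}
    {ρ₁ ρ₂ : RatFunc ℂ} (h₁ : ρ₁ ∈ RatT0) (h₂ : ρ₂ ∈ RatT0)
    (hs₁ : IsSplitting p ω g f₁ ρ₁) (hs₂ : IsSplitting p ω g f₂ ρ₂) : f₁ = f₂ ∧ ρ₁ = ρ₂ := by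
  have hroots (ψ : RatFunc ℂ) : ∀ᵐ t ∂circleMeasure, ψ.denom.eval (pt t) ≠ 0 := by
    filter_upwards [pt_ne_ae _ ψ.denom.roots.toFinset.finite_toSet] with t ht h
    exact ht (by simpa [ψ.denom_ne_zero] using h)
  have hadd : ∀ᵐ t ∂circleMeasure,
      ratEval ρ₁ (pt t) = ratEval ρ₂ (pt t) + ratEval (ρ₁ - ρ₂) (pt t) := by
    filter_upwards [hroots ρ₂, hroots (ρ₁ - ρ₂)] with t h2 h3
    have := RatFunc.eval_add (RingHom.id ℂ) (pt t) (x := ρ₂) (y := ρ₁ - ρ₂)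
      (by simpa [Polynomial.eval₂_id] using h2) (by simpa [Polynomial.eval₂_id] using h3)
    rwa [add_sub_cancel] at this
  have hρ : ρ₁ - ρ₂ = 0 := by
    refine eq_zero_of_integrable (RatT0_sub h₁ h₂)
      (((integrable_LpT p f₂).sub (integrable_LpT p f₁)).congr ?_)
    filter_upwards [hs₁, hs₂, hadd] with t a b c
    rw [Pi.sub_apply]
    linear_combination a - b + c
  have hρ' := sub_eq_zero.1 hρ
  refine ⟨Lp.ext ?_, hρ'⟩
  filter_upwards [hs₁, hs₂] with t a b
  rw [hρ'] at a
  linear_combination b - a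

/-- `H^p ∩ K^p = 0`, so that the Riesz projection is uniquely determined. -/
lemma hardy_disjoint (p : ℝ≥0∞) [Fact (1 ≤ p)] : Disjoint (Hardy p) (HardyCompl p) := by
  rw [Submodule.disjoint_def]
  intro f hf hf'
  have hi := integrable_LpT p f
  have hcoef : ∀ n : ℤ, fourierCoeff f n = 0 := fun n =>
    (lt_or_ge n 0).elim (hf n) (hf' n)
  have hbound (φ : C(UnitAddCircle, ℂ)) : Integrable (fun t => φ t * f t) circleMeasure :=
    hi.bdd_mul φ.continuous.aestronglyMeasurable (c := ‖φ‖)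
      (Filter.Eventually.of_forall fun t => φ.norm_coe_le_norm t)
  let L : C(UnitAddCircle, ℂ) →L[ℂ] ℂ := LinearMap.mkContinuous
    { toFun := fun φ => ∫ t, φ t * f t ∂circleMeasure
      map_add' := fun φ χ => by
        rw [← integral_add (hbound φ) (hbound χ)]
        simp only [ContinuousMap.add_apply, add_mul]
      map_smul' := fun c φ => by
        simp only [ContinuousMap.smul_apply, smul_eq_mul, mul_assoc, integral_const_mul,
          RingHom.id_apply] }
    (∫ t, ‖f t‖ ∂circleMeasure)
    (fun φ => by
      refine (norm_integral_le_integral_norm _).trans ?_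
      rw [← integral_mul_const]
      refine integral_mono (hbound φ).norm (hi.norm.mul_const _) fun t => ?_
      simp only [norm_mul]
      rw [mul_comm]
      exact mul_le_mul_of_nonneg_left (φ.norm_coe_le_norm t) (norm_nonneg _))
  have hL : ∀ φ, L φ = 0 := by
    have h1 : Submodule.span ℂ (Set.range (@fourier (1 : ℝ))) ≤ LinearMap.ker L.toLinearMap := by
      rw [Submodule.span_le]
      rintro _ ⟨n, rfl⟩
      have := hcoef (-n)
      simpa [fourierCoeff, L] using this
    have h2 := Submodule.topologicalClosure_minimal _ h1 L.isClosed_ker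
    rw [span_fourier_closure_eq_top] at h2
    exact fun φ => h2 (Submodule.mem_top (x := φ))
  have h0 : (f : UnitAddCircle → ℂ) =ᵐ[circleMeasure] 0 := by
    refine ae_eq_zero_of_forall_setIntegral_isClosed_eq_zero hi fun s hs => ?_
    have hlim := thickenedIndicator_tendsto_indicator_closure
      (fun n : ℕ => Nat.one_div_pos_of_nat (α := ℝ)) tendsto_one_div_add_atTop_nhds_zero_nat s
    have ht : Filter.Tendsto (fun n : ℕ => ∫ t,
        ((thickenedIndicator (Nat.one_div_pos_of_nat (α := ℝ) (n := n)) s t : NNReal) : ℂ) * f t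
          ∂circleMeasure) Filter.atTop (nhds (∫ t, s.indicator (fun t => f t) t ∂circleMeasure)) := by
      refine tendsto_integral_of_dominated_convergence (fun t => ‖f t‖) (fun n => ?_) hi.norm
        (fun n => Filter.Eventually.of_forall fun t => ?_)
        (Filter.Eventually.of_forall fun t => ?_)
      · refine AEStronglyMeasurable.mul ?_ hi.1
        have : Continuous fun t : UnitAddCircle =>
          ((thickenedIndicator (Nat.one_div_pos_of_nat (α := ℝ) (n := n)) s t : NNReal) : ℂ) := by
          fun_prop
        exact this.aestronglyMeasurable
      · rw [norm_mul]
        refine mul_le_of_le_one_left (norm_nonneg _) ?_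
        have := thickenedIndicator_le_one (Nat.one_div_pos_of_nat (α := ℝ) (n := n)) s t
        simpa using this
      · have h1 := (tendsto_pi_nhds.1 hlim) t
        rw [hs.closure_eq] at h1
        have h2 := (((Complex.continuous_ofReal.comp NNReal.continuous_coe).tendsto _).comp
          h1).mul_const (f t)
        refine (congrArg _ (congrArg nhds ?_)).mp h2
        by_cases hts : t ∈ s <;> simp [hts]
    rw [integral_indicator hs.measurableSet] at ht
    refine tendsto_nhds_unique ht ?_
    refine tendsto_const_nhds.congr fun n => ?_
    exact (hL ⟨fun t =>
      ((thickenedIndicator (Nat.one_div_pos_of_nat (α := ℝ) (n := n)) s t : NNReal) : ℂ),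
      by fun_prop⟩).symm
  exact Lp.eq_zero_iff_ae_eq_zero.2 h0

lemma rieszProj_eq {p : ℝ≥0∞} [Fact (1 ≤ p)] {f : LpT p} {h : Hardy p}
    (hf : f - (h : LpT p) ∈ HardyCompl p) : rieszProj p f = h := by
  have hex : ∃ h : Hardy p, f - (h : LpT p) ∈ HardyCompl p := ⟨h, hf⟩
  rw [rieszProj, dif_pos hex]
  have h1 := (HardyCompl p).sub_mem hf hex.choose_spec
  rw [sub_sub_sub_cancel_left] at h1
  have h2 := Submodule.disjoint_def.1 (hardy_disjoint p) _
    ((Hardy p).sub_mem hex.choose.2 h.2) h1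
  exact Subtype.ext (sub_eq_zero.1 h2)

/-- `T_ω g = ℙ f` for every splitting `ω g = f + ρ`. -/
lemma toeplitz_eq {p : ℝ≥0∞} [Fact (1 ≤ p)] {ω : RatFunc ℂ} {g : Hardy p} {f : LpT p}
    {ρ : RatFunc ℂ} (hρ : ρ ∈ RatT0) (hs : IsSplitting p ω g f ρ) :
    rieszProj p f ∈ toeplitz p ω g := by
  have hex : ∃ f : LpT p, ∃ ρ ∈ RatT0, IsSplitting p ω g f ρ := ⟨f, ρ, hρ, hs⟩
  refine ⟨hex, ?_⟩
  obtain ⟨ρ', hρ', hs'⟩ := hex.choose_spec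
  exact congrArg (rieszProj p) (splitting_unique hρ' hρ hs' hs).1

end WellDefined

end ToeplitzLike

end

/-! The operator reduces to polynomial algebra: $T_\omega g=F$ exactly when $sg=qF+r$ with $\deg
r<\deg q$ (`mem_toeplitz_iff`). If $\omega g=f+\rho$, then $q\rho$ is a polynomial up to a strictly
proper remainder with poles on $\mathbb{T}$; the remainder is integrable, hence zero. So $qf=sg-r\in
H^p$, and since all roots of $q$ lie on $\mathbb{T}$, already $f\in H^p$ (`mem_hardy_of_aeval_mem`)
and $\mathbb{P}f=f$. Bézout for $s,q$ and division by $q$ then give domain and range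
(`toeplitz_dom`, `toeplitz_ran`), wherever the roots of $s$ lie, so the closed range question
becomes one about $sH^p+\widetilde{\mathcal P}$.

Here $\widetilde{\mathcal P}$ is finite-dimensional and multiplication by $s$ is injective on $H^p$,
so closedness of the sum means that this multiplication is bounded below. If $s$ has no roots on
$\mathbb{T}$, the minimum of $|s|$ there is a lower bound. Conversely, a lower bound on $H^p$
extends to $L^p$, because powers of $z$ act isometrically and push trigonometric polynomials into
$H^p$; on $L^p$ it is violated by the indicator of a small neighbourhood of a root
(`eval_ne_zero_of_antilipschitz`). -/

/-- If the range of an injective operator becomes closed after adding a finite-dimensional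
space, the operator is bounded below. -/
lemma ContinuousLinearMap.exists_antilipschitz_of_isClosed_range_sup {X Y : Type*}
    [NormedAddCommGroup X] [NormedSpace ℂ X] [CompleteSpace X]
    [NormedAddCommGroup Y] [NormedSpace ℂ Y] [CompleteSpace Y]
    (f : X →L[ℂ] Y) (hf : Function.Injective f) (V : Submodule ℂ Y) [FiniteDimensional ℂ V]
    (hc : IsClosed ((LinearMap.range f.toLinearMap ⊔ V : Submodule ℂ Y) : Set Y)) :
    ∃ K, AntilipschitzWith K f := by
  set R := LinearMap.range f.toLinearMap with hR
  -- Replacing `V` by a complement `W` of `R ⊓ V` inside `V` keeps the sum with `R` and makes it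
  -- direct, so that `f.coprod W.subtypeL` is injective.
  obtain ⟨W, hWV, hdisj, hsup⟩ : ∃ W ≤ V, Disjoint (R ⊓ V) W ∧ R ⊓ V ⊔ W = V := by
    obtain ⟨W, hW⟩ := Submodule.exists_isCompl (R ⊓ V)
    refine ⟨W ⊓ V, inf_le_right, hW.disjoint.mono_right inf_le_left, ?_⟩
    rw [← sup_inf_assoc_of_le W (inf_le_right : R ⊓ V ≤ V), hW.sup_eq_top, top_inf_eq]
  have : FiniteDimensional ℂ W := Submodule.finiteDimensional_of_le hWV
  have : CompleteSpace W := FiniteDimensional.complete ℂ W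
  set g : X × W →L[ℂ] Y := f.coprod W.subtypeL with hg
  have hginj : Function.Injective g := by
    rw [injective_iff_map_eq_zero]
    rintro ⟨x, w⟩ h
    have h1 : f x + w = 0 := by simpa [hg] using h
    have h2 : (w : Y) ∈ R :=
      ⟨-x, by simpa using neg_eq_of_add_eq_zero_right h1⟩
    have h3 : (w : Y) = 0 := Submodule.disjoint_def.1 hdisj _ ⟨h2, hWV w.2⟩ w.2
    rw [h3, add_zero] at h1
    rw [Prod.mk_eq_zero]
    exact ⟨(map_eq_zero_iff f hf).1 h1, Subtype.ext h3⟩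
  have hgr : Set.range g = ((R ⊔ V : Submodule ℂ Y) : Set Y) := by
    have h1 : R ⊔ V = R ⊔ W := by
      rw [← hsup, ← sup_assoc, sup_inf_self]
    rw [h1]
    ext y
    simp only [Set.mem_range, SetLike.mem_coe, Submodule.mem_sup, Prod.exists, hg,
      ContinuousLinearMap.coprod_apply, Submodule.subtypeL_apply]
    constructor
    · rintro ⟨x, w, rfl⟩
      exact ⟨f x, ⟨x, rfl⟩, w, w.2, rfl⟩
    · rintro ⟨_, ⟨x, rfl⟩, w, hw, rfl⟩
      exact ⟨x, ⟨w, hw⟩, rfl⟩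
  obtain ⟨K, hK⟩ := (g.isClosed_range_iff_antilipschitz_of_injective hginj).1 (hgr ▸ hc)
  refine ⟨K, fun x y => ?_⟩
  have := hK (x, 0) (y, 0)
  simpa [hg, Prod.edist_eq] using this

noncomputable section

namespace ToeplitzLike

/-! ### Multiplication by polynomials and Fourier coefficients on $L^p$ and $H^p$ -/

lemma pt_eq_fourier (t : UnitAddCircle) : pt t = fourier 1 t := by
  rw [fourier_one, pt]

lemma continuous_pt : Continuous pt := by
  have : pt = fun t => fourier 1 t := funext pt_eq_fourier
  rw [this]
  fun_prop

lemma norm_pt (t : UnitAddCircle) : ‖pt t‖ = 1 := Circle.norm_coe _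

lemma continuous_eval_pt (a : ℂ[X]) : Continuous fun t => a.eval (pt t) :=
  a.continuous.comp continuous_pt

section Shift

variable (p : ℝ≥0∞)

lemma memLp_pt_mul (f : LpT p) : MemLp (fun t => pt t * f t) p circleMeasure :=
  (Lp.memLp f).of_le (continuous_pt.aestronglyMeasurable.mul (Lp.aestronglyMeasurable f))
    (Filter.Eventually.of_forall fun t => by rw [norm_mul, norm_pt, one_mul])

variable [Fact (1 ≤ p)]

/-- Multiplication by the coordinate `z` on `L^p(𝕋)`. -/
def shift : LpT p →L[ℂ] LpT p :=
  LinearMap.mkContinuous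
    { toFun := fun f => (memLp_pt_mul p f).toLp
      map_add' := fun f g => by
        refine Lp.ext ?_
        filter_upwards [(memLp_pt_mul p (f + g)).coeFn_toLp, (memLp_pt_mul p f).coeFn_toLp,
          (memLp_pt_mul p g).coeFn_toLp, Lp.coeFn_add f g, Lp.coeFn_add
          (memLp_pt_mul p f).toLp (memLp_pt_mul p g).toLp] with t h1 h2 h3 h4 h5
        rw [h1, h5, h4, Pi.add_apply, Pi.add_apply, h2, h3, mul_add]
      map_smul' := fun c f => by
        refine Lp.ext ?_
        filter_upwards [(memLp_pt_mul p (c • f)).coeFn_toLp, (memLp_pt_mul p f).coeFn_toLp,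
          Lp.coeFn_smul c f, Lp.coeFn_smul c (memLp_pt_mul p f).toLp] with t h1 h2 h3 h4
        rw [RingHom.id_apply, h1, h4, h3, Pi.smul_apply, Pi.smul_apply, h2, smul_eq_mul,
          smul_eq_mul, mul_left_comm] }
    1 (fun f => by
      refine Lp.norm_le_mul_norm_of_ae_le_mul ?_
      filter_upwards [(memLp_pt_mul p f).coeFn_toLp] with t h
      rw [LinearMap.coe_mk, AddHom.coe_mk, h, norm_mul, norm_pt])

lemma coeFn_shift (f : LpT p) : ∀ᵐ t ∂circleMeasure, shift p f t = pt t * f t :=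
  (memLp_pt_mul p f).coeFn_toLp

/-- Multiplication by a polynomial on `L^p(𝕋)`. -/
lemma coeFn_aeval_shift (a : ℂ[X]) (f : LpT p) :
    ∀ᵐ t ∂circleMeasure, aeval (shift p) a f t = a.eval (pt t) * f t := by
  induction a using Polynomial.induction_on' generalizing f with
  | add a b ha hb =>
    rw [map_add, add_apply]
    filter_upwards [ha f, hb f, Lp.coeFn_add (aeval (shift p) a f) (aeval (shift p) b f)]
      with t h1 h2 h3
    rw [h3, Pi.add_apply, h1, h2, eval_add, add_mul]
  | monomial n c =>
    rw [aeval_monomial, ← Algebra.smul_def, smul_apply]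
    have hn : ∀ᵐ t ∂circleMeasure, ((shift p) ^ n) f t = pt t ^ n * f t := by
      induction n with
      | zero => simp
      | succ n ih =>
        rw [pow_succ', mul_apply_eq_comp]
        filter_upwards [ih, coeFn_shift p (((shift p) ^ n) f)] with t h1 h2
        rw [h2, h1, pow_succ', mul_assoc]
    filter_upwards [hn, Lp.coeFn_smul c (((shift p) ^ n) f)] with t h1 h2
    rw [h2, Pi.smul_apply, h1, eval_monomial, smul_eq_mul, mul_assoc]

/-- The circle has total mass one, so the $L^1$ norm is at most the $L^p$ norm. -/
lemma norm_fourierCoeff_le (f : LpT p) (n : ℤ) : ‖fourierCoeff f n‖ ≤ ‖f‖ := by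
  have h1 : ‖fourierCoeff f n‖ ≤ ∫ t, ‖f t‖ ∂circleMeasure := by
    refine (norm_integral_le_integral_norm _).trans_eq (integral_congr_ae ?_)
    refine Filter.Eventually.of_forall fun t => ?_
    simp only [norm_smul, fourier_apply, Circle.norm_coe, one_mul]
  refine h1.trans ?_
  rw [integral_norm_eq_lintegral_enorm (Lp.aestronglyMeasurable f), ← eLpNorm_one_eq_lintegral_enorm,
    Lp.norm_def]
  exact ENNReal.toReal_mono (Lp.eLpNorm_ne_top f)
    (eLpNorm_le_eLpNorm_of_exponent_le Fact.out (Lp.aestronglyMeasurable f))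

/-- The `n`-th Fourier coefficient as a functional on `L^p(𝕋)`. -/
def fourierCoeffL (n : ℤ) : LpT p →L[ℂ] ℂ :=
  LinearMap.mkContinuous
    { toFun := fun f => fourierCoeff f n
      map_add' := fun f g => fourierCoeff_add p f g n
      map_smul' := fun c f => fourierCoeff_smul p c f n }
    1 (fun f => by simpa using norm_fourierCoeff_le p f n)

lemma fourierCoeffL_apply (n : ℤ) (f : LpT p) : fourierCoeffL p n f = fourierCoeff f n := rfl

lemma isClosed_hardy : IsClosed (Hardy p : Set (LpT p)) := by
  have : (Hardy p : Set (LpT p)) = ⋂ n : ℤ, ⋂ _ : n < 0, {f | fourierCoeffL p n f = 0} := by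
    ext f
    simp only [Set.mem_iInter]
    rfl
  rw [this]
  exact isClosed_iInter fun n => isClosed_iInter fun _ =>
    isClosed_eq (fourierCoeffL p n).continuous continuous_const

instance : CompleteSpace (Hardy p) := (isClosed_hardy p).completeSpace_coe

lemma fourierCoeff_shift (f : LpT p) (n : ℤ) :
    fourierCoeff (shift p f) n = fourierCoeff f (n - 1) := by
  rw [fourierCoeff_congr_ae (coeFn_shift p f)]
  refine integral_congr_ae (Filter.Eventually.of_forall fun t => ?_)
  simp only [smul_eq_mul]
  rw [pt_eq_fourier, ← mul_assoc, ← fourier_add, neg_sub, neg_add_eq_sub]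

lemma fourierCoeff_fourierLp (m n : ℤ) :
    fourierCoeff (fourierLp p m : LpT p) n = if n = m then 1 else 0 := by
  -- Coefficients depend only on the function up to null sets, so the computation can be moved to
  -- $L^2$ and its Fourier basis.
  rw [fourierCoeff_congr_ae (coeFn_fourierLp p m),
    ← fourierCoeff_congr_ae (coeFn_fourierLp 2 m), ← fourierBasis_repr, ← coe_fourierBasis,
    HilbertBasis.repr_self, lp.single_apply]
  simp [Pi.single_apply]

/-- Riemann–Lebesgue: trigonometric polynomials are dense for $p\ne\infty$, their coefficients
vanish eventually, and the coefficient functionals have norm at most one. -/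
lemma tendsto_fourierCoeff_atBot (hp : p ≠ ∞) (f : LpT p) :
    Filter.Tendsto (fun n : ℤ => fourierCoeff f n) Filter.atBot (nhds 0) := by
  have hspan : ∀ g ∈ Submodule.span ℂ (Set.range (fourierLp (T := 1) p)),
      ∀ᶠ n : ℤ in Filter.atBot, fourierCoeff g n = 0 := by
    intro g hg
    induction hg using Submodule.span_induction with
    | mem x hx =>
      obtain ⟨m, rfl⟩ := hx
      filter_upwards [Filter.eventually_lt_atBot m] with n hn
      rw [fourierCoeff_fourierLp, if_neg hn.ne]
    | zero => exact Filter.Eventually.of_forall (fourierCoeff_zero p)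
    | add x y _ _ hx hy =>
      filter_upwards [hx, hy] with n h1 h2
      rw [fourierCoeff_add, h1, h2, add_zero]
    | smul c x _ hx =>
      filter_upwards [hx] with n h1
      rw [fourierCoeff_smul, h1, mul_zero]
  rw [Metric.tendsto_nhds]
  intro ε hε
  have hf : f ∈ closure (Submodule.span ℂ (Set.range (fourierLp (T := 1) p)) : Set (LpT p)) := by
    rw [← Submodule.topologicalClosure_coe, span_fourierLp_closure_eq_top hp]
    trivial
  obtain ⟨g, hg, hfg⟩ := Metric.mem_closure_iff.1 hf ε hε
  filter_upwards [hspan g hg] with n hn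
  have h1 := norm_fourierCoeff_le p (f - g) n
  rw [← fourierCoeffL_apply, map_sub, fourierCoeffL_apply, fourierCoeffL_apply, hn, sub_zero] at h1
  rw [dist_zero_right]
  exact h1.trans_lt (by rwa [← dist_eq_norm])

lemma shift_mem_hardy {f : LpT p} (hf : f ∈ Hardy p) : shift p f ∈ Hardy p := fun n hn => by
  rw [fourierCoeff_shift]
  exact hf _ (by lia)

/-- Multiplication by the coordinate `z` on `H^p`. -/
def hardyShift : Hardy p →L[ℂ] Hardy p := (shift p).restrict fun _ => shift_mem_hardy p

lemma coe_aeval_hardyShift (a : ℂ[X]) (h : Hardy p) :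
    (aeval (hardyShift p) a h : LpT p) = aeval (shift p) a h := by
  induction a using Polynomial.induction_on' generalizing h with
  | add a b ha hb => simp [ha, hb]
  | monomial n c =>
    simp only [aeval_monomial, ← Algebra.smul_def, smul_apply,
      Submodule.coe_smul]
    congr 1
    induction n with
    | zero => rfl
    | succ n ih =>
      rw [pow_succ', pow_succ', mul_apply_eq_comp, mul_apply_eq_comp,
        ← ih]
      rfl

/-- The hypothesis says $\hat f(n-1)=\alpha\hat f(n)$ for $n<0$. As $|\alpha|=1$, the moduli of the
negative coefficients are constant towards $-\infty$, and Riemann–Lebesgue makes them zero. -/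
lemma mem_hardy_of_linear_mul_mem (hp : p ≠ ∞) {α : ℂ} (hα : ‖α‖ = 1) {f : LpT p}
    (hf : aeval (shift p) (X - C α) f ∈ Hardy p) : f ∈ Hardy p := by
  have hrec : ∀ n : ℤ, n < 0 → ‖fourierCoeff f (n - 1)‖ = ‖fourierCoeff f n‖ := by
    intro n hn
    have h1 := hf n hn
    have h2 : aeval (shift p) (X - C α) f = shift p f - α • f := by
      simp [Algebra.algebraMap_eq_smul_one]
    rw [h2, ← fourierCoeffL_apply, map_sub, map_smul, fourierCoeffL_apply, fourierCoeffL_apply,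
      fourierCoeff_shift, sub_eq_zero] at h1
    rw [h1, norm_smul, hα, one_mul]
  intro n hn
  have hconst : ∀ k : ℕ, ‖fourierCoeff f (n - k)‖ = ‖fourierCoeff f n‖ := by
    intro k
    induction k with
    | zero => simp
    | succ k ih =>
      rw [← ih, ← hrec (n - k) (by lia), Nat.cast_succ, sub_sub]
  have hlim : Filter.Tendsto (fun k : ℕ => ‖fourierCoeff f (n - k)‖) Filter.atTop (nhds 0) := by
    have h1 : Filter.Tendsto (fun k : ℕ => n - (k : ℤ)) Filter.atTop Filter.atBot := by
      simp only [sub_eq_add_neg]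
      exact Filter.tendsto_atBot_add_const_left _ _
        (Filter.tendsto_neg_atTop_atBot.comp tendsto_natCast_atTop_atTop)
    simpa using ((tendsto_fourierCoeff_atBot p hp f).comp h1).norm
  simp only [hconst] at hlim
  exact norm_eq_zero.1 (tendsto_nhds_unique tendsto_const_nhds hlim)

/-- An `L^p` function is in `H^p` if its product with a polynomial with roots on `𝕋` is. -/
lemma mem_hardy_of_aeval_mem (hp : p ≠ ∞) (q : ℂ[X]) (hq : q ≠ 0)
    (hroots : ∀ z : ℂ, q.IsRoot z → ‖z‖ = 1) {f : LpT p}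
    (hf : aeval (shift p) q f ∈ Hardy p) : f ∈ Hardy p := by
  induction hn : q.natDegree generalizing q with
  | zero =>
    rw [eq_C_of_natDegree_eq_zero hn] at hf hq
    have hc : q.coeff 0 ≠ 0 := by simpa using hq
    rw [aeval_C, Algebra.algebraMap_eq_smul_one] at hf
    exact ((Hardy p).smul_mem_iff hc).1 hf
  | succ n ih =>
    obtain ⟨α, hα⟩ := IsAlgClosed.exists_root q (by
      rw [degree_eq_natDegree hq, hn]
      exact_mod_cast n.succ_ne_zero)
    obtain ⟨r, rfl⟩ := dvd_iff_isRoot.2 hα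
    have hr : r ≠ 0 := right_ne_zero_of_mul hq
    refine ih r hr (fun z hz => hroots z (hz.dvd (dvd_mul_left _ _)))
      (mem_hardy_of_linear_mul_mem p hp (hroots α hα) ?_) ?_
    · rwa [map_mul, mul_apply_eq_comp] at hf
    · rw [natDegree_mul (X_sub_C_ne_zero α) hr, natDegree_X_sub_C] at hn
      lia

end Shift

/-! ### Rational functions on the circle and polynomial multiples in $H^p$ -/

lemma ae_eval_pt_ne_zero {a : ℂ[X]} (ha : a ≠ 0) : ∀ᵐ t ∂circleMeasure, a.eval (pt t) ≠ 0 := by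
  filter_upwards [pt_ne_ae _ a.roots.toFinset.finite_toSet] with t ht h
  exact ht (by simpa [ha] using h)

lemma ratEval_eq (ψ : RatFunc ℂ) (z : ℂ) : ratEval ψ z = ψ.num.eval z / ψ.denom.eval z := by
  simp [ratEval, RatFunc.eval, eval₂_id]

lemma ratEval_div (a : ℂ[X]) {b : ℂ[X]} {z : ℂ} (hb : b.eval z ≠ 0) :
    ratEval (algebraMap ℂ[X] (RatFunc ℂ) a / algebraMap ℂ[X] (RatFunc ℂ) b) z
      = a.eval z / b.eval z := by
  have hb0 : b ≠ 0 := by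
    rintro rfl
    simp at hb
  set ψ := algebraMap ℂ[X] (RatFunc ℂ) a / algebraMap ℂ[X] (RatFunc ℂ) b with hψ
  have h1 : ψ.denom.eval z ≠ 0 := fun h =>
    hb (IsRoot.dvd h ((RatFunc.denom_dvd hb0).2 ⟨a, rfl⟩))
  have h2 := congrArg (Polynomial.eval z) ((RatFunc.num_mul_eq_mul_denom_iff hb0).2 hψ)
  rw [eval_mul, eval_mul] at h2
  rw [ratEval_eq, div_eq_div_iff h1 hb, h2]

lemma div_mem_RatT0 {a b : ℂ[X]} (hb : b ≠ 0) (hroots : ∀ z : ℂ, b.IsRoot z → ‖z‖ = 1)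
    (hdeg : a.degree < b.degree) :
    algebraMap ℂ[X] (RatFunc ℂ) a / algebraMap ℂ[X] (RatFunc ℂ) b ∈ RatT0 := by
  set ψ := algebraMap ℂ[X] (RatFunc ℂ) a / algebraMap ℂ[X] (RatFunc ℂ) b with hψ
  refine ⟨fun z hz => hroots z (hz.dvd ((RatFunc.denom_dvd hb).2 ⟨a, rfl⟩)), ?_⟩
  have h1 := (RatFunc.num_mul_eq_mul_denom_iff hb).2 hψ
  by_contra hcon
  have h2 : (a * ψ.denom).degree < b.degree + ψ.denom.degree := by
    rw [degree_mul]
    exact WithBot.add_lt_add_right (degree_ne_bot.2 ψ.denom_ne_zero) hdeg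
  rw [← h1, degree_mul, add_comm] at h2
  exact absurd h2 (not_lt.2 (add_le_add_right (not_lt.1 hcon) _))

/-- Coprimality forces $q$ to divide the reduced denominator of $s/q$, so no root of $q$ is lost by
cancellation. -/
lemma norm_eq_one_of_isRoot {s q : ℂ[X]} (hsq : IsCoprime s q) (hq : q ≠ 0)
    (hω : algebraMap ℂ[X] (RatFunc ℂ) s / algebraMap ℂ[X] (RatFunc ℂ) q ∈ RatT) {z : ℂ}
    (hz : q.IsRoot z) : ‖z‖ = 1 :=
  hω z (hz.dvd (hsq.symm.dvd_of_dvd_mul_left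
    ⟨_, ((RatFunc.num_mul_eq_mul_denom_iff hq).2 rfl).symm.trans (mul_comm _ _)⟩))

variable (p : ℝ≥0∞) [Fact (1 ≤ p)]

/-- The constant function `1` as an element of `H^p`. -/
def hardyOne : Hardy p := ⟨fourierLp p 0, fun n hn => by
  rw [fourierCoeff_fourierLp, if_neg hn.ne]⟩

lemma coeFn_hardyOne : ∀ᵐ t ∂circleMeasure, (hardyOne p : LpT p) t = 1 := by
  filter_upwards [coeFn_fourierLp p 0] with t ht
  rw [hardyOne, ht, fourier_zero]

lemma coeFn_aeval_hardyShift (a : ℂ[X]) (h : Hardy p) :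
    ∀ᵐ t ∂circleMeasure, (aeval (hardyShift p) a h : LpT p) t = a.eval (pt t) * (h : LpT p) t := by
  rw [coe_aeval_hardyShift]
  exact coeFn_aeval_shift p a h

lemma coeFn_aeval_add_aeval_one (a r : ℂ[X]) (h : Hardy p) : ∀ᵐ t ∂circleMeasure,
    ((aeval (hardyShift p) a h + aeval (hardyShift p) r (hardyOne p) : Hardy p) : LpT p) t
      = a.eval (pt t) * (h : LpT p) t + r.eval (pt t) := by
  rw [Submodule.coe_add]
  filter_upwards [coeFn_aeval_hardyShift p a h, coeFn_aeval_hardyShift p r (hardyOne p),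
    coeFn_hardyOne p, Lp.coeFn_add (aeval (hardyShift p) a h : LpT p)
      (aeval (hardyShift p) r (hardyOne p) : LpT p)] with t h1 h2 h3 h4
  rw [h4, Pi.add_apply, h1, h2, h3, mul_one]

lemma hardy_ext {f g : Hardy p} (h : ∀ᵐ t ∂circleMeasure, (f : LpT p) t = (g : LpT p) t) :
    f = g :=
  Subtype.ext (Lp.ext h)

/-- Turns the almost-everywhere identity into one in $H^p$, where polynomials act through
`hardyShift` and the later arguments are pure algebra. -/
lemma mem_mulAdd_iff (a : ℂ[X]) (R : Set ℂ[X]) (F : Hardy p) :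
    F ∈ mulAdd p a R ↔ ∃ h : Hardy p, ∃ r ∈ R,
      F = aeval (hardyShift p) a h + aeval (hardyShift p) r (hardyOne p) := by
  refine exists_congr fun h => exists_congr fun r => and_congr_right fun _ => ⟨fun hF => ?_, ?_⟩
  · refine hardy_ext p ?_
    filter_upwards [hF, coeFn_aeval_add_aeval_one p a r h] with t h1 h2
    rw [h1, h2]
  · rintro rfl
    exact coeFn_aeval_add_aeval_one p a r h

/-! ### The graph, domain and range of $T_\omega$ as polynomial relations -/

/-- If `s g = q f + q ρ` with `g ∈ H^p`, `f ∈ L^p` and `ρ ∈ Rat₀(𝕋)`, then `q ρ` is a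
polynomial of degree less than `deg q`. -/
lemma exists_polynomial_of_splitting {s q : ℂ[X]} (hq : q ≠ 0) {g f : LpT p} {ρ : RatFunc ℂ}
    (hρ : ρ ∈ RatT0)
    (hs : IsSplitting p (algebraMap ℂ[X] (RatFunc ℂ) s / algebraMap ℂ[X] (RatFunc ℂ) q) g f ρ) :
    ∃ r ∈ polyLT q.natDegree, ∀ᵐ t ∂circleMeasure,
      s.eval (pt t) * g t = q.eval (pt t) * f t + r.eval (pt t) := by
  have hs' : ∀ᵐ t ∂circleMeasure,
      s.eval (pt t) * g t = q.eval (pt t) * f t + q.eval (pt t) * ratEval ρ (pt t) := by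
    filter_upwards [hs, ae_eval_pt_ne_zero hq] with t h1 h2
    rw [ratEval_div s h2] at h1
    rw [← mul_add, ← h1]
    field_simp
  set d := ρ.num * q / ρ.denom with hd
  set m := ρ.num * q % ρ.denom with hm
  have hdm : ρ.denom * d + m = ρ.num * q := EuclideanDomain.div_add_mod _ _
  -- On $\mathbb{T}$ the remainder term $m/\mathrm{denom}(\rho)$ equals $sg-qf-d$, which is
  -- integrable.
  have hψ : algebraMap ℂ[X] (RatFunc ℂ) m / algebraMap ℂ[X] (RatFunc ℂ) ρ.denom = 0 := by
    refine eq_zero_of_integrable (div_mem_RatT0 ρ.denom_ne_zero hρ.1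
      (degree_mod_lt _ ρ.denom_ne_zero)) ?_
    have hint := ((integrable_LpT p (aeval (shift p) s g)).sub
      (integrable_LpT p (aeval (shift p) q f))).sub
      ((continuous_eval_pt d).integrable_of_hasCompactSupport
        (HasCompactSupport.of_compactSpace _) (μ := circleMeasure))
    refine hint.congr ?_
    filter_upwards [hs', ae_eval_pt_ne_zero ρ.denom_ne_zero, coeFn_aeval_shift p s g,
      coeFn_aeval_shift p q f] with t h1 h2 h3 h4
    have h5 := congrArg (Polynomial.eval (pt t)) hdm
    simp only [eval_add, eval_mul] at h5
    rw [Pi.sub_apply, Pi.sub_apply, h3, h4, h1, ratEval_div m h2, ratEval_eq, eq_div_iff h2]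
    field_simp
    linear_combination -h5
  have hm0 : m = 0 := by
    rw [div_eq_zero_iff] at hψ
    exact (hψ.resolve_right (RatFunc.algebraMap_ne_zero ρ.denom_ne_zero)) |>
      (map_eq_zero_iff _ (RatFunc.algebraMap_injective ℂ)).1
  rw [hm0, add_zero] at hdm
  refine ⟨d, ?_, ?_⟩
  · rw [polyLT, Set.mem_ofPred_eq, ← degree_eq_natDegree hq]
    by_contra hcon
    have h1 : (ρ.num * q).degree < ρ.denom.degree + q.degree := by
      rw [degree_mul]
      exact WithBot.add_lt_add_right (degree_ne_bot.2 hq) hρ.2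
    rw [← hdm, degree_mul] at h1
    exact absurd h1 (not_lt.2 (add_le_add_right (not_lt.1 hcon) _))
  · filter_upwards [hs', ae_eval_pt_ne_zero ρ.denom_ne_zero] with t h1 h2
    have h5 := congrArg (Polynomial.eval (pt t)) hdm
    simp only [eval_mul] at h5
    rw [h1, ratEval_eq]
    field_simp
    linear_combination -h5

/-- `T_ω g = F` means that `s g = q F + r` for a polynomial `r` of degree less than `deg q`. -/
lemma mem_toeplitz_iff (hp : p ≠ ∞) {s q : ℂ[X]} (hsq : IsCoprime s q) (hq : q ≠ 0)
    (hω : algebraMap ℂ[X] (RatFunc ℂ) s / algebraMap ℂ[X] (RatFunc ℂ) q ∈ RatT)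
    (g F : Hardy p) :
    F ∈ toeplitz p (algebraMap ℂ[X] (RatFunc ℂ) s / algebraMap ℂ[X] (RatFunc ℂ) q) g ↔
      ∃ r ∈ polyLT q.natDegree, aeval (hardyShift p) s g
        = aeval (hardyShift p) q F + aeval (hardyShift p) r (hardyOne p) := by
  have hriesz (h : Hardy p) : rieszProj p (h : LpT p) = h :=
    rieszProj_eq (by rw [sub_self]; exact zero_mem _)
  constructor
  · rintro ⟨hex, rfl⟩
    obtain ⟨ρ, hρ, hs⟩ := hex.choose_spec
    change ∃ r ∈ polyLT q.natDegree, _ = aeval (hardyShift p) q (rieszProj p hex.choose) + _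
    generalize hex.choose = f at hs
    obtain ⟨r, hr, hsr⟩ := exists_polynomial_of_splitting p hq hρ hs
    have heq : aeval (shift p) q f
        = ((aeval (hardyShift p) s g - aeval (hardyShift p) r (hardyOne p) : Hardy p) : LpT p) := by
      refine Lp.ext ?_
      rw [Submodule.coe_sub]
      filter_upwards [hsr, coeFn_aeval_shift p q f, coeFn_aeval_hardyShift p s g,
        coeFn_aeval_hardyShift p r (hardyOne p), coeFn_hardyOne p,
        Lp.coeFn_sub (aeval (hardyShift p) s g : LpT p)
          (aeval (hardyShift p) r (hardyOne p) : LpT p)] with t h1 h2 h3 h4 h5 h6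
      rw [h6, Pi.sub_apply, h2, h3, h4, h5]
      linear_combination -h1
    -- Once `f` is known to lie in $H^p$, the projection fixes it, and `heq` becomes the required
    -- relation.
    have hf : f ∈ Hardy p := mem_hardy_of_aeval_mem p hp q hq
      (fun z hz => norm_eq_one_of_isRoot hsq hq hω hz) (heq ▸ Subtype.property _)
    lift f to Hardy p using hf
    refine ⟨r, hr, ?_⟩
    rw [hriesz, ← sub_eq_iff_eq_add, ← Subtype.coe_inj, ← heq, coe_aeval_hardyShift]
  · rintro ⟨r, hr, heq⟩
    rw [← hriesz F]
    refine toeplitz_eq (div_mem_RatT0 hq (fun z hz => norm_eq_one_of_isRoot hsq hq hω hz)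
      ((degree_eq_natDegree hq).symm ▸ hr : r.degree < q.degree)) ?_
    have h0 := coeFn_aeval_add_aeval_one p q r F
    rw [← heq] at h0
    filter_upwards [h0, coeFn_aeval_hardyShift p s g, ae_eval_pt_ne_zero hq] with t h1 h2 h3
    rw [h2] at h1
    rw [ratEval_div s h3, ratEval_div r h3]
    field_simp
    exact h1

lemma aeval_hardyShift_injective {q : ℂ[X]} (hq : q ≠ 0) :
    Function.Injective (aeval (hardyShift p) q) := by
  intro f g h
  refine hardy_ext p ?_
  have h1 := coeFn_aeval_hardyShift p q f
  rw [h] at h1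
  filter_upwards [h1, coeFn_aeval_hardyShift p q g, ae_eval_pt_ne_zero hq] with t h2 h3 h4
  exact mul_left_cancel₀ h4 (h2.symm.trans h3)

lemma aeval_mul_hardyShift (a b : ℂ[X]) (h : Hardy p) :
    aeval (hardyShift p) (a * b) h = aeval (hardyShift p) a (aeval (hardyShift p) b h) := by
  rw [map_mul, mul_apply_eq_comp]

lemma mod_mem_polyLT (a : ℂ[X]) {q : ℂ[X]} (hq : q ≠ 0) : a % q ∈ polyLT q.natDegree := by
  rw [polyLT, Set.mem_ofPred_eq, ← degree_eq_natDegree hq]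
  exact degree_mod_lt a hq

/-- With $as+bq=1$ and $sg=qF+r$ one gets $g=q(aF+bg)+ar$, and $ar$ is reduced modulo $q$.
Conversely, for $g=qh+r$, dividing $sr$ by $q$ exhibits $T_\omega g$ as $sh$ plus the quotient. -/
lemma toeplitz_dom (hp : p ≠ ∞) {s q : ℂ[X]} (hsq : IsCoprime s q) (hq : q ≠ 0)
    (hω : algebraMap ℂ[X] (RatFunc ℂ) s / algebraMap ℂ[X] (RatFunc ℂ) q ∈ RatT) :
    (toeplitz p (algebraMap ℂ[X] (RatFunc ℂ) s / algebraMap ℂ[X] (RatFunc ℂ) q)).Dom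
      = mulAdd p q (polyLT q.natDegree) := by
  ext g
  rw [PFun.mem_dom, mem_mulAdd_iff]
  simp only [mem_toeplitz_iff p hp hsq hq hω]
  constructor
  · rintro ⟨F, r, -, heq⟩
    obtain ⟨a, b, hab⟩ := hsq
    refine ⟨aeval (hardyShift p) a F + aeval (hardyShift p) b g
      + aeval (hardyShift p) (a * r / q) (hardyOne p), a * r % q, mod_mem_polyLT _ hq, ?_⟩
    calc g = aeval (hardyShift p) (a * s + b * q) g := by rw [hab]; simp
      _ = aeval (hardyShift p) (q * a) F + aeval (hardyShift p) (q * b) g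
          + aeval (hardyShift p) (q * (a * r / q) + a * r % q) (hardyOne p) := by
        rw [EuclideanDomain.div_add_mod, map_add, add_apply, aeval_mul_hardyShift, heq, map_add,
          ← aeval_mul_hardyShift, ← aeval_mul_hardyShift, mul_comm a q, mul_comm b q]
        abel
      _ = _ := by
        simp only [map_add, add_apply, aeval_mul_hardyShift]
        abel
  · rintro ⟨h, r, -, rfl⟩
    refine ⟨aeval (hardyShift p) s h + aeval (hardyShift p) (s * r / q) (hardyOne p),
      s * r % q, mod_mem_polyLT _ hq, ?_⟩
    rw [map_add, map_add, ← aeval_mul_hardyShift, ← aeval_mul_hardyShift, ← aeval_mul_hardyShift,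
      ← aeval_mul_hardyShift, add_assoc, ← add_apply, ← map_add, EuclideanDomain.div_add_mod,
      mul_comm s q]

lemma toeplitz_ran (hp : p ≠ ∞) {s q : ℂ[X]} (hsq : IsCoprime s q) (hq : q ≠ 0)
    (hω : algebraMap ℂ[X] (RatFunc ℂ) s / algebraMap ℂ[X] (RatFunc ℂ) q ∈ RatT) :
    (toeplitz p (algebraMap ℂ[X] (RatFunc ℂ) s / algebraMap ℂ[X] (RatFunc ℂ) q)).ran
      = mulAdd p s (tildeP s q) := by
  ext F
  rw [mem_mulAdd_iff]
  change (∃ g, _) ↔ _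
  simp only [mem_toeplitz_iff p hp hsq hq hω]
  constructor
  · rintro ⟨g, r, hr, heq⟩
    have hF := (mem_toeplitz_iff p hp hsq hq hω g F).2 ⟨r, hr, heq⟩
    have hg : g ∈ mulAdd p q (polyLT q.natDegree) := by
      rw [← toeplitz_dom p hp hsq hq hω, PFun.mem_dom]
      exact ⟨F, hF⟩
    obtain ⟨h, r₁, hr₁, rfl⟩ := (mem_mulAdd_iff p _ _ _).1 hg
    -- For $g=qh+r_1$, division of $sr_1$ by $q$ shows that $sh$ plus the quotient is a value at
    -- $g$; single-valuedness identifies it with $F$. The negated remainder plays the role of $r_2$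
    -- in $\widetilde{\mathcal P}$.
    refine ⟨h, s * r₁ / q, ⟨r₁, hr₁, -(s * r₁ % q), ?_, ?_⟩, Part.mem_unique hF
      ((mem_toeplitz_iff p hp hsq hq hω _ _).2 ⟨s * r₁ % q, mod_mem_polyLT _ hq, ?_⟩)⟩
    · rw [polyLT, Set.mem_ofPred_eq, degree_neg]
      exact mod_mem_polyLT _ hq
    · linear_combination EuclideanDomain.div_add_mod (s * r₁) q
    · rw [map_add, map_add, ← aeval_mul_hardyShift, ← aeval_mul_hardyShift,
        ← aeval_mul_hardyShift, ← aeval_mul_hardyShift, add_assoc, ← add_apply, ← map_add,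
        EuclideanDomain.div_add_mod, mul_comm s q]
  · rintro ⟨h, r, ⟨r₁, hr₁, r₂, hr₂, hr⟩, rfl⟩
    refine ⟨aeval (hardyShift p) q h + aeval (hardyShift p) r₁ (hardyOne p), -r₂, ?_, ?_⟩
    · rw [polyLT, Set.mem_ofPred_eq, degree_neg]
      exact hr₂
    · have h1 : r₁ * s = q * r + -r₂ := by rw [mul_comm q, hr]; ring
      rw [map_add, map_add, ← aeval_mul_hardyShift, ← aeval_mul_hardyShift,
        ← aeval_mul_hardyShift, ← aeval_mul_hardyShift, mul_comm s r₁, h1, map_add, add_apply,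
        mul_comm s q, add_assoc]

/-! ### Closedness of $sH^p+\widetilde{\mathcal P}$ and the roots of $s$ -/

/-- The set `𝒫̃` as a subspace of `ℂ[X]`. -/
def tildePSubmodule (s q : ℂ[X]) : Submodule ℂ ℂ[X] where
  carrier := tildeP s q
  add_mem' := by
    rintro a b ⟨r₁, hr₁, r₂, hr₂, h⟩ ⟨u₁, hu₁, u₂, hu₂, k⟩
    exact ⟨r₁ + u₁, (degree_add_le _ _).trans_lt (max_lt hr₁ hu₁),
      r₂ + u₂, (degree_add_le _ _).trans_lt (max_lt hr₂ hu₂), by linear_combination h + k⟩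
  zero_mem' := ⟨0, by simp [polyLT], 0, by simp [polyLT], by simp⟩
  smul_mem' := by
    rintro c a ⟨r₁, hr₁, r₂, hr₂, h⟩
    exact ⟨c • r₁, (degree_smul_le _ _).trans_lt hr₁, c • r₂, (degree_smul_le _ _).trans_lt hr₂,
      by rw [smul_mul_assoc, h, smul_add, smul_mul_assoc]⟩

/-- A crude bound, $\deg r\le\deg(rq)$, is enough for finite dimension. -/
lemma tildePSubmodule_le_degreeLT {s q : ℂ[X]} (hs : s ≠ 0) (hq : q ≠ 0) :
    tildePSubmodule s q ≤ degreeLT ℂ (q.natDegree + s.natDegree) := by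
  rintro r ⟨r₁, hr₁, r₂, hr₂, h⟩
  rw [mem_degreeLT]
  refine (degree_le_mul_left r hq).trans_lt ?_
  rw [h]
  refine (degree_add_le _ _).trans_lt (max_lt ?_ (lt_of_lt_of_le hr₂ ?_))
  · rw [degree_mul, degree_eq_natDegree hs, Nat.cast_add]
    exact WithBot.add_lt_add_right (WithBot.coe_ne_bot) hr₁
  · exact_mod_cast Nat.le_add_right _ _

lemma finiteDimensional_tildePSubmodule {s q : ℂ[X]} (hs : s ≠ 0) (hq : q ≠ 0) :
    FiniteDimensional ℂ (tildePSubmodule s q) := by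
  have : FiniteDimensional ℂ (degreeLT ℂ (q.natDegree + s.natDegree)) :=
    (degreeLTEquiv ℂ _).symm.finiteDimensional
  exact Submodule.finiteDimensional_of_le (tildePSubmodule_le_degreeLT hs hq)

/-- A polynomial as an element of `H^p`. -/
def polyToHardy : ℂ[X] →ₗ[ℂ] Hardy p where
  toFun r := aeval (hardyShift p) r (hardyOne p)
  map_add' a b := by rw [map_add, add_apply]
  map_smul' c a := by rw [map_smul, smul_apply, RingHom.id_apply]

lemma coe_range_sup_eq_mulAdd (s q : ℂ[X]) :
    ((LinearMap.range (aeval (hardyShift p) s).toLinearMap ⊔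
      (tildePSubmodule s q).map (polyToHardy p) : Submodule ℂ (Hardy p)) : Set (Hardy p))
      = mulAdd p s (tildeP s q) := by
  ext F
  rw [mem_mulAdd_iff, SetLike.mem_coe, Submodule.mem_sup]
  constructor
  · rintro ⟨_, ⟨h, rfl⟩, _, ⟨r, hr, rfl⟩, rfl⟩
    exact ⟨h, r, hr, rfl⟩
  · rintro ⟨h, r, hr, rfl⟩
    exact ⟨_, ⟨h, rfl⟩, _, ⟨r, hr, rfl⟩, rfl⟩

/-- By compactness $|s|$ has a positive minimum on $\mathbb{T}$; its inverse serves as the constant,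
by a pointwise estimate. -/
lemma exists_antilipschitz_aeval_hardyShift {s : ℂ[X]}
    (hs : ∀ z : ℂ, ‖z‖ = 1 → s.eval z ≠ 0) :
    ∃ K, AntilipschitzWith K (aeval (hardyShift p) s) := by
  obtain ⟨z₀, hz₀, hmin⟩ := (isCompact_sphere (0 : ℂ) 1).exists_isMinOn
    (NormedSpace.sphere_nonempty.2 zero_le_one) s.continuous.norm.continuousOn
  have hc : 0 < ‖s.eval z₀‖ := norm_pos_iff.2 (hs z₀ (by simpa using hz₀))
  refine ⟨‖s.eval z₀‖₊⁻¹, ContinuousLinearMap.antilipschitz_of_bound _ fun h => ?_⟩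
  change ‖(h : LpT p)‖ ≤ _ * ‖(aeval (hardyShift p) s h : LpT p)‖
  refine Lp.norm_le_mul_norm_of_ae_le_mul ?_
  filter_upwards [coeFn_aeval_hardyShift p s h] with t ht
  rw [ht, norm_mul, NNReal.coe_inv, coe_nnnorm, ← div_eq_inv_mul, le_div_iff₀ hc, mul_comm]
  exact mul_le_mul_of_nonneg_right (hmin (by simp [norm_pt])) (norm_nonneg _)

lemma norm_shift_pow (n : ℕ) (f : LpT p) : ‖(shift p ^ n) f‖ = ‖f‖ := by
  have h1 := coeFn_aeval_shift p (X ^ n) f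
  rw [aeval_X_pow] at h1
  rw [Lp.norm_def, Lp.norm_def]
  congr 1
  refine eLpNorm_congr_norm_ae ?_
  filter_upwards [h1] with t ht
  rw [ht, norm_mul, eval_pow, eval_X, norm_pow, norm_pt, one_pow, one_mul]

lemma fourierCoeff_shift_pow (n : ℕ) (f : LpT p) (k : ℤ) :
    fourierCoeff ((shift p ^ n) f) k = fourierCoeff f (k - n) := by
  induction n generalizing k with
  | zero => simp
  | succ n ih =>
    rw [pow_succ', mul_apply_eq_comp, fourierCoeff_shift, ih, Nat.cast_succ, sub_sub, add_comm 1]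

lemma eventually_shift_pow_mem_hardy {g : LpT p}
    (hg : g ∈ Submodule.span ℂ (Set.range (fourierLp (T := 1) p))) :
    ∀ᶠ n : ℕ in Filter.atTop, (shift p ^ n) g ∈ Hardy p := by
  induction hg using Submodule.span_induction with
  | mem x hx =>
    obtain ⟨m, rfl⟩ := hx
    filter_upwards [tendsto_natCast_atTop_atTop.eventually (Filter.eventually_ge_atTop (-m))]
      with n hn k hk
    rw [fourierCoeff_shift_pow, fourierCoeff_fourierLp, if_neg (by lia)]
  | zero => simp
  | add x y _ _ hx hy =>
    filter_upwards [hx, hy] with n h1 h2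
    rw [map_add]
    exact add_mem h1 h2
  | smul c x _ hx =>
    filter_upwards [hx] with n h1
    rw [map_smul]
    exact Submodule.smul_mem _ _ h1

/-- A lower bound for multiplication by a polynomial on `H^p` extends to `L^p`. -/
lemma norm_le_of_antilipschitz (hp : p ≠ ∞) {s : ℂ[X]} {K : NNReal}
    (hK : AntilipschitzWith K (aeval (hardyShift p) s)) (f : LpT p) :
    ‖f‖ ≤ K * ‖aeval (shift p) s f‖ := by
  have hf : f ∈ closure (Submodule.span ℂ (Set.range (fourierLp (T := 1) p)) : Set (LpT p)) := by
    rw [← Submodule.topologicalClosure_coe, span_fourierLp_closure_eq_top hp]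
    trivial
  refine closure_minimal (s := (Submodule.span ℂ (Set.range (fourierLp (T := 1) p)) : Set (LpT p)))
    (t := {f | ‖f‖ ≤ K * ‖aeval (shift p) s f‖}) (fun g hg => ?_)
    (isClosed_le (by fun_prop) (by fun_prop)) hf
  -- Multiplication by $z^n$ is isometric and commutes with that by $s$, so the bound for $z^ng\in
  -- H^p$ is the bound for $g$.
  obtain ⟨n, hn⟩ := (eventually_shift_pow_mem_hardy p hg).exists
  have h1 := hK.le_mul_norm_sub ⟨_, hn⟩ 0
  rw [map_zero, add_zero, add_zero, norm_neg, norm_neg] at h1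
  change ‖(shift p ^ n) g‖ ≤ K * ‖(aeval (hardyShift p) s ⟨_, hn⟩ : LpT p)‖ at h1
  rw [coe_aeval_hardyShift] at h1
  have h2 : aeval (shift p) s ((shift p ^ n) g) = (shift p ^ n) (aeval (shift p) s g) := by
    rw [← aeval_X_pow (R := ℂ) (shift p), ← mul_apply_eq_comp, ← mul_apply_eq_comp, ← map_mul, ← map_mul,
      mul_comm]
  rwa [h2, norm_shift_pow, norm_shift_pow] at h1

lemma eval_ne_zero_of_antilipschitz (hp : p ≠ ∞) {s : ℂ[X]} {K : NNReal}
    (hK : AntilipschitzWith K (aeval (hardyShift p) s)) {z : ℂ} (hz : ‖z‖ = 1) :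
    s.eval z ≠ 0 := by
  intro hsz
  obtain ⟨t₀, ht₀⟩ : ∃ t₀, pt t₀ = z := by
    obtain ⟨t₀, h⟩ := (AddCircle.homeomorphCircle one_ne_zero).surjective
      ⟨z, mem_sphere_zero_iff_norm.2 hz⟩
    exact ⟨t₀, by rw [AddCircle.homeomorphCircle_apply] at h; rw [pt, h]⟩
  have hc : (0 : ℝ) < (K + 1)⁻¹ := by positivity
  -- The threshold $1/(K+1)$ makes $K|s|\le K/(K+1)<1$ on `A`, so the indicator of `A` contradicts
  -- the lower bound on $L^p$.
  set A : Set UnitAddCircle := {t | ‖s.eval (pt t)‖ < ((K : ℝ) + 1)⁻¹} with hA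
  have hAo : IsOpen A := isOpen_lt (continuous_eval_pt s).norm continuous_const
  have hApos : 0 < circleMeasure A :=
    hAo.measure_pos _ ⟨t₀, by simpa [hA, ht₀, hsz] using hc⟩
  set f : LpT p := indicatorConstLp p hAo.measurableSet (measure_ne_top _ A) (1 : ℂ) with hf
  have hf0 : 0 < ‖f‖ := by
    rw [hf, norm_indicatorConstLp (zero_lt_one.trans_le Fact.out).ne' hp, norm_one, one_mul]
    exact Real.rpow_pos_of_pos (ENNReal.toReal_pos hApos.ne' (measure_ne_top _ A)) _
  have h1 : ‖aeval (shift p) s f‖ ≤ ((K : ℝ) + 1)⁻¹ * ‖f‖ := by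
    refine Lp.norm_le_mul_norm_of_ae_le_mul ?_
    filter_upwards [coeFn_aeval_shift p s f, (indicatorConstLp_coeFn :
      indicatorConstLp p hAo.measurableSet (measure_ne_top circleMeasure A) (1 : ℂ) =ᵐ[_] _)]
      with t h2 h3
    rw [h2, norm_mul, hf, h3]
    by_cases ht : t ∈ A
    · exact mul_le_mul_of_nonneg_right (le_of_lt ht) (norm_nonneg _)
    · simp [Set.indicator_of_notMem ht]
  have h2 := (norm_le_of_antilipschitz p hp hK f).trans
    (mul_le_mul_of_nonneg_left h1 K.coe_nonneg)
  rw [← mul_assoc, ← div_eq_mul_inv] at h2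
  have h3 : (K : ℝ) / (K + 1) < 1 := (div_lt_one (by positivity)).2 (lt_add_one _)
  nlinarith

lemma isClosed_mulAdd_iff (hp : p ≠ ∞) {s q : ℂ[X]} (hs : s ≠ 0) (hq : q ≠ 0) :
    IsClosed (mulAdd p s (tildeP s q)) ↔ ∀ z : ℂ, ‖z‖ = 1 → s.eval z ≠ 0 := by
  have := finiteDimensional_tildePSubmodule hs hq
  have hinj := aeval_hardyShift_injective p hs
  rw [← coe_range_sup_eq_mulAdd]
  constructor
  · intro h z hz
    obtain ⟨K, hK⟩ := ContinuousLinearMap.exists_antilipschitz_of_isClosed_range_sup _ hinj _ h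
    exact eval_ne_zero_of_antilipschitz p hp hK hz
  · intro h
    exact Submodule.isClosed_sup_finiteDimensional _ _
      ((ContinuousLinearMap.isClosed_range_iff_antilipschitz_of_injective _ hinj).2
        (exists_antilipschitz_aeval_hardyShift p h))

end ToeplitzLike
end

theorem theoremT (p : ℝ≥0∞) [Fact (1 ≤ p)] (hp : 1 < p) (hp' : p < ∞)
    (ω : RatFunc ℂ) (hω : ω ∈ ToeplitzLike.RatT) (hω0 : ω ≠ 0)
    (s q : ℂ[X]) (hsq : IsCoprime s q) (hq : q ≠ 0)
    (hωsq : ω = algebraMap ℂ[X] (RatFunc ℂ) s / algebraMap ℂ[X] (RatFunc ℂ) q) :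
    (IsClosed (ToeplitzLike.toeplitz p ω).ran ↔ ∀ z : ℂ, ‖z‖ = 1 → s.eval z ≠ 0) ∧
    ((∀ z : ℂ, ‖z‖ = 1 → s.eval z ≠ 0) ↔
      IsClosed (ToeplitzLike.mulAdd p s (ToeplitzLike.tildeP s q))) ∧
    ((∀ z : ℂ, ‖z‖ = 1 → s.eval z ≠ 0) →
      (ToeplitzLike.toeplitz p ω).Dom =
          ToeplitzLike.mulAdd p q (ToeplitzLike.polyLT q.natDegree) ∧
        (ToeplitzLike.toeplitz p ω).ran =
          ToeplitzLike.mulAdd p s (ToeplitzLike.tildeP s q)) := by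
  subst hωsq
  have hs : s ≠ 0 := by
    rintro rfl
    simp at hω0
  have hran := ToeplitzLike.toeplitz_ran p hp'.ne hsq hq hω
  have hiff := ToeplitzLike.isClosed_mulAdd_iff p hp'.ne hs hq
  exact ⟨by rw [hran, hiff], hiff.symm,
    fun _ => ⟨ToeplitzLike.toeplitz_dom p hp'.ne hsq hq hω, hran⟩⟩
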